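/- Let $\mathbb T=\{w\in\mathbb C:|w|=1\}$ and let $\mathcal M(\mathbb T)$ be the set of Borel probability measures on $\mathbb C$ carried by $\mathbb T$. For $\mu\in\mathcal M(\mathbb T)$, $z\in\mathbb C$ and an integer $n\ge 0$ let $$\lambda_n(\mu,z)=\inf\Big\{\int |p|^2\,d\mu \;:\; p\in\mathbb C[w],\ \deg p\le n,\ p(z)=1\Big\}$$ be the Christoffel function, and let $\lambda_\infty(\mu,z)=\lim_{n\to\infty}\lambda_n(\mu,z)$. For $|z|<1$, a Borel measure $\nu$ on $\mathbb C$ is called a balayage of the unit point mass $\delta_z$ onto $\mathbb T$ if it is carried by $\mathbb T$ and $\int h\,d\nu=h(z)$ for every real function $h$ that is continuous on the closed unit disk and harmonic in the open unit disk. **Theorem.** Let $z\in\mathbb C$ with $|z|<1$. Then: 1. there is exactly one balayage $\hat\delta_z$ of $\delta_z$ onto $\mathbb T$, and it is the harmonic measure $$d\hat\delta_z(e^{it})=\frac{1-|z|^2}{|e^{it}-z|^2}\,\frac{dt}{2\pi};$$ 2. for every $\mu\in\mathcal M(\mathbb T)$ the limit $\lambda_\infty(\mu,z)$ exists as a real number;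 3. $\hat\delta_z$ is the unique maximizer of $\mu\mapsto\lambda_\infty(\mu,z)$ over $\mathcal M(\mathbb T)$: it belongs to $\mathcal M(\mathbb T)$, it attains the maximum, and no other $\mu\in\mathcal M(\mathbb T)$ does. -/

import Mathlib

open MeasureTheory Filter Topology Polynomial

noncomputable section

/-- The probability measures on the plane that are carried by the compact set `K`. -/
def probOn (K : Set ℂ) : Set (Measure ℂ) :=
  {μ | IsProbabilityMeasure μ ∧ μ Kᶜ = 0}

/-- The Christoffel function of `μ` of degree `n` at `z`: the infimum of `∫ |p|² dμ` over the
polynomials `p` of degree at most `n` with `p(z) = 1`. -/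
def christoffel (n : ℕ) (μ : Measure ℂ) (z : ℂ) : ℝ :=
  sInf {r : ℝ | ∃ p : ℂ[X], p.natDegree ≤ n ∧ p.eval z = 1 ∧ r = ∫ w, ‖p.eval w‖ ^ 2 ∂μ}

/-- The limit of the Christoffel functions of `μ` at `z` as the degree tends to infinity. -/
def christoffelLim (μ : Measure ℂ) (z : ℂ) : ℝ :=
  limUnder atTop (fun n : ℕ => christoffel n μ z)

/-- The harmonic measure of the unit disk at `z`: the measure on the unit circle whose density in
the angle `t` is the normalized Poisson kernel `(1 - |z|²) / (2 π |exp (i t) - z|²)`. -/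
def harmonicMeasureDisk (z : ℂ) : Measure ℂ :=
  ((volume.restrict (Set.Ioc 0 (2 * Real.pi))).withDensity fun t : ℝ =>
    ENNReal.ofReal ((1 - ‖z‖ ^ 2) / ‖Complex.exp (t * Complex.I) - z‖ ^ 2 / (2 * Real.pi))).map
      fun t : ℝ => Complex.exp (t * Complex.I)

/-- `ν` is a balayage onto the unit circle of the unit point mass at the point `z` of the open unit
disk: it is carried by the circle, and integrates every function that is continuous on the closed
disk and harmonic in the open disk to its value at `z`. (The constant `1` forces mass one.) -/
def IsBalayageDisk (z : ℂ) (ν : Measure ℂ) : Prop :=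
  ν (Metric.sphere (0 : ℂ) 1)ᶜ = 0 ∧
    ∀ h : ℂ → ℝ, InnerProductSpace.HarmonicContOnCl h (Metric.ball (0 : ℂ) 1) → ∫ w, h w ∂ν = h z

end

open Metric InnerProductSpace ComplexConjugate
open scoped BoundedContinuousFunction

/-! Balayages of the point mass and maximizers are both the measures on the circle that reproduce
polynomials, `∫ p dμ = p(z)`. Testing with `p = 1` bounds the limit by `1`. Writing competitors as
`1 + q` with `q(z) = 0`, expansion of `|1 + q|²` shows that the bound is attained if every `∫ q dμ`
vanishes, and a variation `1 + c q` shows the converse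
(`integral_polynomial_of_one_le_christoffelLim`). By Stone–Weierstrass at most one measure
reproduces polynomials (`eq_of_integral_polynomial_eq`); by Poisson's formula the harmonic measure
does. -/

/-! ### Polynomial moments of measures on the circle -/

lemma ae_mem_of_measure_compl_eq_zero {K : Set ℂ} {μ : Measure ℂ} (h : μ Kᶜ = 0) :
    ∀ᵐ w ∂μ, w ∈ K :=
  measure_eq_zero_iff_ae_notMem.1 h |>.mono fun w hw => by simpa using hw

lemma integrable_of_continuousOn_sphere {E : Type*} [NormedAddCommGroup E] {μ : Measure ℂ}
    [IsFiniteMeasure μ] (hμ : μ (sphere (0 : ℂ) 1)ᶜ = 0) {f : ℂ → E}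
    (hf : ContinuousOn f (sphere (0 : ℂ) 1)) : Integrable f μ := by
  have h := hf.integrableOn_compact (μ := μ) (isCompact_sphere 0 1)
  rwa [IntegrableOn, Measure.restrict_eq_self_of_ae_mem (ae_mem_of_measure_compl_eq_zero hμ)] at h

lemma integrable_polynomial_eval {μ : Measure ℂ} [IsFiniteMeasure μ]
    (hμ : μ (sphere (0 : ℂ) 1)ᶜ = 0) (p : ℂ[X]) : Integrable (fun w => p.eval w) μ :=
  integrable_of_continuousOn_sphere hμ p.continuous.continuousOn

lemma conj_eq_inv_of_mem_sphere {w : ℂ} (hw : w ∈ sphere (0 : ℂ) 1) : conj w = w⁻¹ := by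
  rw [mem_sphere_zero_iff_norm] at hw
  exact (Complex.inv_eq_conj hw).symm

/-- Carried by the circle, the analytic moments determine all trigonometric moments. -/
lemma integral_zpow_eq {μ ν : Measure ℂ} (hμ : μ (sphere (0 : ℂ) 1)ᶜ = 0)
    (hν : ν (sphere (0 : ℂ) 1)ᶜ = 0) (h : ∀ p : ℂ[X], ∫ w, p.eval w ∂μ = ∫ w, p.eval w ∂ν)
    (k : ℤ) : ∫ w, w ^ k ∂μ = ∫ w, w ^ k ∂ν := by
  have key (n : ℕ) : ∫ w, w ^ n ∂μ = ∫ w, w ^ n ∂ν := by simpa using h (X ^ n)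
  obtain ⟨n, rfl | rfl⟩ := k.eq_nat_or_neg
  · simpa using key n
  · have conv {ρ : Measure ℂ} (hρ : ρ (sphere (0 : ℂ) 1)ᶜ = 0) :
        ∫ w, w ^ (-(n : ℤ)) ∂ρ = conj (∫ w, w ^ n ∂ρ) := by
      rw [← integral_conj]
      refine integral_congr_ae ?_
      filter_upwards [ae_mem_of_measure_compl_eq_zero hρ] with w hw
      simp [conj_eq_inv_of_mem_sphere hw]
    rw [conv hμ, conv hν, key]

lemma integral_zpow_mul_polynomial_eq {μ ν : Measure ℂ} [IsFiniteMeasure μ] [IsFiniteMeasure ν]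
    (hμ : μ (sphere (0 : ℂ) 1)ᶜ = 0) (hν : ν (sphere (0 : ℂ) 1)ᶜ = 0)
    (h : ∀ p : ℂ[X], ∫ w, p.eval w ∂μ = ∫ w, p.eval w ∂ν) (N : ℤ) (p : ℂ[X]) :
    ∫ w, w ^ N * p.eval w ∂μ = ∫ w, w ^ N * p.eval w ∂ν := by
  have conv {ρ : Measure ℂ} [IsFiniteMeasure ρ] (hρ : ρ (sphere (0 : ℂ) 1)ᶜ = 0) :
      ∫ w, w ^ N * p.eval w ∂ρ = p.sum fun i a => a * ∫ w, w ^ (N + i) ∂ρ := by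
    rw [Polynomial.sum]
    simp_rw [← integral_const_mul]
    rw [← integral_finsetSum]
    · refine integral_congr_ae ?_
      filter_upwards [ae_mem_of_measure_compl_eq_zero hρ] with w hw
      rw [eval_eq_sum, Polynomial.sum, Finset.mul_sum]
      refine Finset.sum_congr rfl fun i _ => ?_
      rw [zpow_add₀ (ne_zero_of_mem_unit_sphere ⟨w, hw⟩), zpow_natCast]
      ring
    · intro i _
      refine (integrable_of_continuousOn_sphere hρ fun w hw => ?_).const_mul _
      exact (continuousAt_zpow₀ w _ (Or.inl (ne_zero_of_mem_unit_sphere ⟨w, hw⟩))).continuousWithinAt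
  simp_rw [conv hμ, conv hν, integral_zpow_eq hμ hν h]

/-- Finite measures on the unit circle are determined by their integrals of polynomials. -/
theorem eq_of_integral_polynomial_eq {μ ν : Measure ℂ} [IsFiniteMeasure μ] [IsFiniteMeasure ν]
    (hμ : μ (sphere (0 : ℂ) 1)ᶜ = 0) (hν : ν (sphere (0 : ℂ) 1)ᶜ = 0)
    (h : ∀ p : ℂ[X], ∫ w, p.eval w ∂μ = ∫ w, p.eval w ∂ν) : μ = ν := by
  set S := sphere (0 : ℂ) 1
  have hSm : MeasurableSet S := isClosed_sphere.measurableSet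
  have hemb := MeasurableEmbedding.subtype_coe hSm
  have back {ρ : Measure ℂ} (hρ : ρ Sᶜ = 0) :
      (ρ.comap ((↑) : S → ℂ)).map ((↑) : S → ℂ) = ρ := by
    rw [map_comap_subtype_coe hSm,
      Measure.restrict_eq_self_of_ae_mem (ae_mem_of_measure_compl_eq_zero hρ)]
  have fin {ρ : Measure ℂ} [IsFiniteMeasure ρ] : IsFiniteMeasure (ρ.comap ((↑) : S → ℂ)) := by
    refine ⟨?_⟩
    rw [hemb.comap_apply]
    exact measure_lt_top _ _
  have := fin (ρ := μ)
  have := fin (ρ := ν)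
  have : CompactSpace S := isCompact_iff_compactSpace.1 (isCompact_sphere 0 1)
  let ι : S →ᵇ ℂ := BoundedContinuousFunction.mkOfCompact ⟨(↑), continuous_subtype_val⟩
  have hιv (w : S) : ι w = w := rfl
  rw [← back hμ, ← back hν]
  congr 1
  refine ext_of_forall_mem_subalgebra_integral_eq_of_pseudoEMetric_complete_countable (𝕜 := ℂ)
    (A := StarAlgebra.adjoin ℂ {ι}) ?_ ?_
  · intro x y hxy
    refine ⟨_, ⟨ι.toContinuousMap, ⟨ι, StarAlgebra.self_mem_adjoin_singleton ℂ ι, rfl⟩, rfl⟩, ?_⟩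
    simpa [hιv, Subtype.ext_iff] using hxy
  · intro g hg
    -- On the circle conjugation is inversion, so the star algebra generated by the coordinate
    -- consists of Laurent polynomials.
    obtain ⟨N, p, hp⟩ : ∃ (N : ℕ) (p : ℂ[X]), ∀ w : S, (w : ℂ) ^ N * g w = p.eval (w : ℂ) := by
      induction hg using StarAlgebra.adjoin_induction with
      | mem x hx =>
        obtain rfl : x = ι := hx
        exact ⟨0, X, fun w => by simp [hιv]⟩
      | algebraMap r => exact ⟨0, C r, fun w => by simp⟩
      | add x y _ _ hx hy =>
        obtain ⟨N, p, hp⟩ := hx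
        obtain ⟨M, q, hq⟩ := hy
        refine ⟨N + M, X ^ M * p + X ^ N * q, fun w => ?_⟩
        simp [← hp, ← hq]
        ring
      | mul x y _ _ hx hy =>
        obtain ⟨N, p, hp⟩ := hx
        obtain ⟨M, q, hq⟩ := hy
        refine ⟨N + M, p * q, fun w => ?_⟩
        simp [← hp, ← hq]
        ring
      | star x _ hx =>
        obtain ⟨N, p, hp⟩ := hx
        -- With `d = p.natDegree` and `p̄` the polynomial with conjugated coefficients, `conj x = w
        -- ^ N * p̄(1/w)`, and `w ^ d * p̄(1/w)` is the reversal of `p̄`.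
        refine ⟨p.natDegree, X ^ N * (p.map (starRingEnd ℂ)).reverse, fun w => ?_⟩
        have hw := ne_zero_of_mem_unit_sphere w
        let _ : Invertible (w : ℂ)⁻¹ := invertibleOfNonzero (inv_ne_zero hw)
        have hc : conj (w : ℂ) = (w : ℂ)⁻¹ := conj_eq_inv_of_mem_sphere w.2
        have hr := eval₂_reverse_mul_pow (RingHom.id ℂ) (w : ℂ)⁻¹ (p.map (starRingEnd ℂ))
        have he : (p.map (starRingEnd ℂ)).eval (w : ℂ)⁻¹ = ((w : ℂ) ^ N)⁻¹ * conj (x w) := by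
          rw [← hc, eval_map_apply, ← hp, map_mul, map_pow, hc, inv_pow]
        rw [← eval_map, ← eval_map, Polynomial.map_id, Polynomial.map_id, he, invOf_eq_inv,
          inv_inv, natDegree_map, inv_pow] at hr
        have hwd := pow_ne_zero p.natDegree hw
        have hwN := pow_ne_zero N hw
        rw [eval_mul, eval_pow, eval_X, (mul_inv_eq_iff_eq_mul₀ hwd).1 hr]
        simp only [BoundedContinuousFunction.star_apply, RCLike.star_def]
        field_simp
    have conv (ρ : Measure ℂ) :
        ∫ w, g w ∂(ρ.comap ((↑) : S → ℂ)) =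
          ∫ w in S, w ^ (-(N : ℤ)) * p.eval w ∂ρ := by
      rw [← map_comap_subtype_coe hSm, hemb.integral_map]
      refine integral_congr_ae (.of_forall fun w => ?_)
      have hw := pow_ne_zero N (ne_zero_of_mem_unit_sphere w)
      simp [← hp, hw]
    rw [conv, conv, Measure.restrict_eq_self_of_ae_mem (ae_mem_of_measure_compl_eq_zero hμ),
      Measure.restrict_eq_self_of_ae_mem (ae_mem_of_measure_compl_eq_zero hν)]
    exact integral_zpow_mul_polynomial_eq hμ hν h _ p

/-! ### Harmonic measure as balayage -/

lemma IsBalayageDisk.isProbabilityMeasure {z : ℂ} {ν : Measure ℂ} (h : IsBalayageDisk z ν) :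
    IsProbabilityMeasure ν := by
  have := h.2 (fun _ => 1) harmonicContOnCl_const
  rw [integral_const, smul_eq_mul, mul_one] at this
  -- Infinite mass is excluded too, since its `toReal` is `0`.
  exact ⟨(ENNReal.toReal_eq_one_iff _).1 this⟩

/-- Real and imaginary parts of a polynomial are admissible harmonic test functions. -/
lemma IsBalayageDisk.integral_polynomial {z : ℂ} {ν : Measure ℂ} (h : IsBalayageDisk z ν)
    (p : ℂ[X]) : ∫ w, p.eval w ∂ν = p.eval z := by
  have := h.isProbabilityMeasure
  have hi := integrable_polynomial_eval h.1 p
  have ha (x : ℂ) : AnalyticAt ℂ (fun w => p.eval w) x := p.differentiable.analyticAt x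
  apply Complex.ext
  · rw [← h.2 (fun w => (p.eval w).re)
      (HarmonicOnNhd.harmonicContOnCl fun x _ => (ha x).harmonicAt_re)]
    exact (integral_re hi).symm
  · rw [← h.2 (fun w => (p.eval w).im)
      (HarmonicOnNhd.harmonicContOnCl fun x _ => (ha x).harmonicAt_im)]
    exact (integral_im hi).symm

lemma harmonicMeasureDisk_compl_sphere (z : ℂ) :
    harmonicMeasureDisk z (sphere (0 : ℂ) 1)ᶜ = 0 := by
  have hm : Measurable fun t : ℝ => Complex.exp (t * Complex.I) := by fun_prop
  rw [harmonicMeasureDisk, Measure.map_apply hm isClosed_sphere.measurableSet.compl]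
  have : (fun t : ℝ => Complex.exp (t * Complex.I)) ⁻¹' (sphere (0 : ℂ) 1)ᶜ = ∅ := by
    ext t
    simp [Complex.norm_exp_ofReal_mul_I]
  rw [this, measure_empty]

theorem isBalayageDisk_harmonicMeasureDisk {z : ℂ} (hz : ‖z‖ < 1) :
    IsBalayageDisk z (harmonicMeasureDisk z) := by
  refine ⟨harmonicMeasureDisk_compl_sphere z, fun h hh => ?_⟩
  -- Nothing is known of `h` off the closed disk, so measurability holds only almost everywhere.
  have hmeas : AEStronglyMeasurable h (harmonicMeasureDisk z) := by
    rw [← Measure.restrict_eq_self_of_ae_mem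
      (ae_mem_of_measure_compl_eq_zero (harmonicMeasureDisk_compl_sphere z))]
    exact (hh.continuousOn_ball.mono sphere_subset_closedBall).aestronglyMeasurable
      isClosed_sphere.measurableSet
  have hm : Measurable fun t : ℝ => Complex.exp (t * Complex.I) := by fun_prop
  rw [← hh.circleAverage_poissonKernel_smul (mem_ball_zero_iff.2 hz), harmonicMeasureDisk,
    integral_map hm.aemeasurable hmeas,
    integral_withDensity_eq_integral_toReal_smul (by fun_prop) (by simp), Real.circleAverage_def,
    intervalIntegral.integral_of_le Real.two_pi_pos.le, ← integral_smul]
  refine integral_congr_ae (.of_forall fun t => ?_)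
  have h1 : 0 ≤ 1 - ‖z‖ ^ 2 := by nlinarith [norm_nonneg z]
  have h2 := Real.two_pi_pos
  simp only [Pi.smul_apply', poissonKernel_def, circleMap, sub_zero, zero_add, Complex.ofReal_one,
    one_mul, Complex.norm_exp_ofReal_mul_I, one_pow, smul_eq_mul]
  rw [ENNReal.toReal_ofReal (by positivity)]
  ring

theorem isBalayageDisk_iff {z : ℂ} (hz : ‖z‖ < 1) {ν : Measure ℂ} :
    IsBalayageDisk z ν ↔ ν = harmonicMeasureDisk z := by
  have h0 := isBalayageDisk_harmonicMeasureDisk hz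
  refine ⟨fun h => ?_, fun h => h ▸ h0⟩
  have := h.isProbabilityMeasure
  have := h0.isProbabilityMeasure
  exact eq_of_integral_polynomial_eq h.1 h0.1 fun p => by
    rw [h.integral_polynomial, h0.integral_polynomial]

/-! ### Christoffel functions -/

lemma bddBelow_christoffel (n : ℕ) (μ : Measure ℂ) (z : ℂ) : BddBelow
    {r : ℝ | ∃ p : ℂ[X], p.natDegree ≤ n ∧ p.eval z = 1 ∧ r = ∫ w, ‖p.eval w‖ ^ 2 ∂μ} := by
  refine ⟨0, ?_⟩
  rintro r ⟨p, -, -, rfl⟩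
  positivity

lemma christoffel_le {n : ℕ} (μ : Measure ℂ) {z : ℂ} {p : ℂ[X]} (hn : p.natDegree ≤ n)
    (hp : p.eval z = 1) : christoffel n μ z ≤ ∫ w, ‖p.eval w‖ ^ 2 ∂μ :=
  csInf_le (bddBelow_christoffel n μ z) ⟨p, hn, hp, rfl⟩

lemma le_christoffel {n : ℕ} {μ : Measure ℂ} {z : ℂ} {c : ℝ}
    (h : ∀ p : ℂ[X], p.natDegree ≤ n → p.eval z = 1 → c ≤ ∫ w, ‖p.eval w‖ ^ 2 ∂μ) :
    c ≤ christoffel n μ z := by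
  refine le_csInf ⟨_, 1, by simp, by simp, rfl⟩ ?_
  rintro r ⟨p, hn, hp, rfl⟩
  exact h p hn hp

lemma christoffel_nonneg (n : ℕ) (μ : Measure ℂ) (z : ℂ) : 0 ≤ christoffel n μ z :=
  le_christoffel fun _ _ _ => by positivity

lemma christoffel_antitone (μ : Measure ℂ) (z : ℂ) : Antitone fun n => christoffel n μ z :=
  fun _ _ hmn => le_christoffel fun _ hn hp => christoffel_le μ (hn.trans hmn) hp

lemma tendsto_christoffel (μ : Measure ℂ) (z : ℂ) :
    Tendsto (fun n : ℕ => christoffel n μ z) atTop (𝓝 (christoffelLim μ z)) := by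
  refine tendsto_nhds_limUnder ⟨_, tendsto_atTop_ciInf (christoffel_antitone μ z) ⟨0, ?_⟩⟩
  rintro _ ⟨n, rfl⟩
  exact christoffel_nonneg n μ z

lemma christoffelLim_le_christoffel (n : ℕ) (μ : Measure ℂ) (z : ℂ) :
    christoffelLim μ z ≤ christoffel n μ z :=
  (christoffel_antitone μ z).le_of_tendsto (tendsto_christoffel μ z) n

lemma christoffelLim_le_one (μ : Measure ℂ) [IsProbabilityMeasure μ] (z : ℂ) :
    christoffelLim μ z ≤ 1 :=
  (christoffelLim_le_christoffel 0 μ z).trans <|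
    (christoffel_le μ (p := 1) (by simp) (by simp)).trans (by simp)

lemma integral_norm_one_add_sq {μ : Measure ℂ} [IsProbabilityMeasure μ]
    (hμ : μ (sphere (0 : ℂ) 1)ᶜ = 0) (p : ℂ[X]) :
    ∫ w, ‖(1 + p).eval w‖ ^ 2 ∂μ =
      1 + 2 * (∫ w, p.eval w ∂μ).re + ∫ w, ‖p.eval w‖ ^ 2 ∂μ := by
  have hi := integrable_polynomial_eval hμ p
  have hre : Integrable (fun w => (p.eval w).re) μ := hi.re
  have hsq : Integrable (fun w => ‖p.eval w‖ ^ 2) μ :=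
    integrable_of_continuousOn_sphere hμ (by fun_prop)
  have he : (∫ w, p.eval w ∂μ).re = ∫ w, (p.eval w).re ∂μ := (integral_re hi).symm
  have hpt (w : ℂ) : ‖(1 + p).eval w‖ ^ 2 = 1 + 2 * (p.eval w).re + ‖p.eval w‖ ^ 2 := by
    simp [Complex.sq_norm, Complex.normSq_apply]
    ring
  simp_rw [hpt]
  rw [integral_add (f := fun w => 1 + 2 * (p.eval w).re)
      ((integrable_const _).add (hre.const_mul 2)) hsq,
    integral_add (integrable_const _) (hre.const_mul 2), integral_const_mul, he]
  simp

/-- The cross term of `|1 + (p - 1)|²` integrates to zero because `p - 1` vanishes at `z`. -/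
lemma christoffelLim_eq_one_of_integral_polynomial {z : ℂ} {μ : Measure ℂ}
    [IsProbabilityMeasure μ] (hμ : μ (sphere (0 : ℂ) 1)ᶜ = 0)
    (h : ∀ p : ℂ[X], ∫ w, p.eval w ∂μ = p.eval z) : christoffelLim μ z = 1 := by
  refine (christoffelLim_le_one μ z).antisymm (ge_of_tendsto' (tendsto_christoffel μ z) fun n =>
    le_christoffel fun p _ hp => ?_)
  have := integral_norm_one_add_sq hμ (p - 1)
  rw [add_sub_cancel, h, eval_sub, hp, eval_one, sub_self, Complex.zero_re] at this
  rw [this]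
  have : 0 ≤ ∫ w, ‖(p - 1).eval w‖ ^ 2 ∂μ := by positivity
  linarith

lemma integral_polynomial_of_one_le_christoffelLim {z : ℂ} {μ : Measure ℂ}
    [IsProbabilityMeasure μ] (hμ : μ (sphere (0 : ℂ) 1)ᶜ = 0) (h : 1 ≤ christoffelLim μ z)
    (p : ℂ[X]) : ∫ w, p.eval w ∂μ = p.eval z := by
  have vanish (q : ℂ[X]) (hq : q.eval z = 0) : ∫ w, q.eval w ∂μ = 0 := by
    set J := ∫ w, q.eval w ∂μ
    set B := ∫ w, ‖q.eval w‖ ^ 2 ∂μ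
    have hB0 : 0 ≤ B := by positivity
    have var (c : ℂ) : 0 ≤ 2 * (c * J).re + ‖c‖ ^ 2 * B := by
      have h1 := h.trans <| (christoffelLim_le_christoffel _ μ z).trans <|
        christoffel_le μ (p := 1 + C c * q) le_rfl (by simp [hq])
      rw [integral_norm_one_add_sq hμ] at h1
      simp only [eval_mul, eval_C, norm_mul, mul_pow, integral_const_mul] at h1
      linarith
    -- The quadratic in `c` is least at `-conj J / B`. Using `B + 1` avoids the case `B = 0` and
    -- still gives the negative value `-(B + 2)|J|² / (B + 1)²` when `J ≠ 0`.
    have h2 := var (-(((B + 1)⁻¹ : ℝ) : ℂ) * conj J)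
    rw [mul_assoc, ← Complex.normSq_eq_conj_mul_self] at h2
    rw [norm_mul, norm_neg, Complex.norm_real, RCLike.norm_conj, mul_pow, Real.norm_eq_abs, sq_abs,
      ← Complex.normSq_eq_norm_sq, ← Complex.ofReal_neg, ← Complex.ofReal_mul,
      Complex.ofReal_re] at h2
    by_contra hJ0
    have hN := Complex.normSq_pos.2 hJ0
    have hB1 : 0 < B + 1 := by linarith
    have h3 : (B + 1) ^ 2 * (2 * (-(B + 1)⁻¹ * Complex.normSq J) +
        (B + 1)⁻¹ ^ 2 * Complex.normSq J * B) = -((B + 2) * Complex.normSq J) := by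
      field_simp
      ring
    have h4 : 0 < (B + 2) * Complex.normSq J := by positivity
    have h5 := mul_nonneg (sq_nonneg (B + 1)) h2
    rw [h3] at h5
    linarith
  have := vanish (p - C (p.eval z)) (by simp)
  simp_rw [eval_sub, eval_C] at this
  rw [integral_sub (integrable_polynomial_eval hμ p) (integrable_const _)] at this
  simpa [sub_eq_zero] using this

theorem one_le_christoffelLim_iff {z : ℂ} (hz : ‖z‖ < 1) {μ : Measure ℂ}
    [IsProbabilityMeasure μ] (hμ : μ (sphere (0 : ℂ) 1)ᶜ = 0) :
    1 ≤ christoffelLim μ z ↔ μ = harmonicMeasureDisk z := by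
  have h0 := isBalayageDisk_harmonicMeasureDisk hz
  have := h0.isProbabilityMeasure
  refine ⟨fun h => eq_of_integral_polynomial_eq hμ h0.1 fun p => ?_, ?_⟩
  · rw [integral_polynomial_of_one_le_christoffelLim hμ h, h0.integral_polynomial]
  · rintro rfl
    exact (christoffelLim_eq_one_of_integral_polynomial h0.1 h0.integral_polynomial).ge

theorem theorem3p2 (z : ℂ) (hz : ‖z‖ < 1) :
    -- the balayage of the point mass at `z` exists, is unique, and is the harmonic measure
    (∀ ν : Measure ℂ, IsBalayageDisk z ν ↔ ν = harmonicMeasureDisk z) ∧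
    -- the limit that defines `christoffelLim` exists
    (∀ μ ∈ probOn (Metric.sphere (0 : ℂ) 1),
      Tendsto (fun n : ℕ => christoffel n μ z) atTop (𝓝 (christoffelLim μ z))) ∧
    -- it is the one and only maximizer
    {μ : Measure ℂ | μ ∈ probOn (Metric.sphere (0 : ℂ) 1) ∧
      IsMaxOn (fun μ' : Measure ℂ => christoffelLim μ' z) (probOn (Metric.sphere (0 : ℂ) 1)) μ} =
        {harmonicMeasureDisk z} := by
  refine ⟨fun ν => isBalayageDisk_iff hz, fun μ _ => tendsto_christoffel μ z, ?_⟩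
  have h0 := isBalayageDisk_harmonicMeasureDisk hz
  have hP := h0.isProbabilityMeasure
  have h1 : 1 ≤ christoffelLim (harmonicMeasureDisk z) z :=
    (one_le_christoffelLim_iff hz h0.1).2 rfl
  ext μ
  refine ⟨fun ⟨⟨hp, hμ⟩, hmax⟩ => ?_, ?_⟩
  · exact (one_le_christoffelLim_iff hz hμ).1 (h1.trans (hmax ⟨hP, h0.1⟩))
  · rintro rfl
    refine ⟨⟨hP, h0.1⟩, fun ν hν => ?_⟩
    have := hν.1
    exact (christoffelLim_le_one ν z).trans h1
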